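/- Let $\mathcal M$ be the set of all metrics on $\mathbb N$, regarded as a subspace of $\mathbb R^{\mathbb N\times\mathbb N}$ and equipped with its Borel $\sigma$-algebra, which makes it a standard Borel space. A metric $f\in\mathcal M$ is a code for the infinite Polish metric space $M_f$, the completion of $(\mathbb N,f)$. For $f,g\in\mathcal M$ let - $\rho_{GH}(f,g)\in[0,\infty]$ be the Gromov–Hausdorff distance of $(\mathbb N,f)$ and $(\mathbb N,g)$, that is, the infimum of the Hausdorff distances $\rho_H^X(\iota(\mathbb N),\kappa(\mathbb N))$ over all metric spaces $X$ and all isometric embeddings $\iota:(\mathbb N,f)\to X$ and $\kappa:(\mathbb N,g)\to X$; - $\rho_L(f,g)\in[0,\infty]$ be the Lipschitz distance of $M_f$ and $M_g$, that is, $$\rho_L(f,g)=\inf\big\{\log\max\{\operatorname{Lip}(T),\operatorname{Lip}(T^{-1})\}:\ T:M_f\to M_g\ \text{is a bi-Lipschitz bijection}\big\},\qquad \inf\emptyset=\infty,$$ where $\operatorname{Lip}(T)=\sup_{x\neq y}\frac{d(Tx,Ty)}{d(x,y)}$. A pseudometric $\rho:X\times X\to[0,\infty]$ on a standard Borel space $X$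 is called analytic if the set $\{(x,y)\in X^2:\rho(x,y)<r\}$ is analytic for every real $r>0$. If $\rho_X$ and $\rho_Y$ are analytic pseudometrics on standard Borel spaces $X$ and $Y$, then $\rho_X$ is Borel-uniformly continuous reducible to $\rho_Y$ if there is a Borel map $f:X\to Y$ such that for every $\varepsilon>0$ there are $\delta_X>0$ and $\delta_Y>0$ such that for all $x,y\in X$ $$\rho_X(x,y)<\delta_X\ \Rightarrow\ \rho_Y(f(x),f(y))<\varepsilon\qquad\text{and}\qquad \rho_Y(f(x),f(y))<\delta_Y\ \Rightarrow\ \rho_X(x,y)<\varepsilon.$$ The two pseudometrics are Borel-uniformly continuous bi-reducible if each of them is Borel-uniformly continuous reducible to the other. **Theorem.** $\rho_{GH}$ and $\rho_L$ are analytic pseudometrics on $\mathcal M$, and they are Borel-uniformly continuous bi-reducible. -/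

import Mathlib

open Set MeasureTheory
open scoped ENNReal

/-- `d` is a metric on `ℕ` (nonnegativity follows from the three conditions). -/
def IsMetricOnNat (d : ℕ → ℕ → ℝ) : Prop :=
  (∀ i j, d i j = 0 ↔ i = j) ∧ (∀ i j, d i j = d j i) ∧ (∀ i j k, d i k ≤ d i j + d j k)

/-- The space `𝓜` of all metrics on `ℕ`, the standard Borel space of (codes of) all infinite
Polish metric spaces. -/
def MetricCode : Type := {d : ℕ → ℕ → ℝ // IsMetricOnNat d}

namespace MetricCode

/-- The topology of pointwise convergence, inherited from `ℝ^(ℕ × ℕ)`. -/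
instance : TopologicalSpace MetricCode :=
  inferInstanceAs (TopologicalSpace {d : ℕ → ℕ → ℝ // IsMetricOnNat d})

/-- The σ-algebra inherited from `ℝ^(ℕ × ℕ)`. -/
instance : MeasurableSpace MetricCode :=
  inferInstanceAs (MeasurableSpace {d : ℕ → ℕ → ℝ // IsMetricOnNat d})

/-- The σ-algebra of `𝓜` consists of the Borel sets of the topology of `𝓜`. -/
instance : BorelSpace MetricCode :=
  inferInstanceAs (BorelSpace {d : ℕ → ℕ → ℝ // IsMetricOnNat d})

theorem measurableSet_isMetricOnNat : MeasurableSet {d : ℕ → ℕ → ℝ | IsMetricOnNat d} := by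
  have hm : ∀ i j : ℕ, Measurable fun d : ℕ → ℕ → ℝ => d i j := fun i j =>
    (measurable_pi_apply j).comp (measurable_pi_apply i)
  unfold IsMetricOnNat
  refine MeasurableSet.inter ?_ (MeasurableSet.inter ?_ ?_)
  · refine measurableSet_setOfPred.2 (Measurable.forall fun i => Measurable.forall fun j => ?_)
    exact Measurable.iff (measurableSet_setOfPred.1 (measurableSet_eq_fun (hm i j) measurable_const))
      measurable_const
  · refine measurableSet_setOfPred.2 (Measurable.forall fun i => Measurable.forall fun j => ?_)
    exact measurableSet_setOfPred.1 (measurableSet_eq_fun (hm i j) (hm j i))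
  · refine measurableSet_setOfPred.2 (Measurable.forall fun i => Measurable.forall fun j =>
      Measurable.forall fun k => ?_)
    exact measurableSet_setOfPred.1 (measurableSet_le (hm i k) ((hm i j).add (hm j k)))

/-- `𝓜` is a standard Borel space. -/
instance : StandardBorelSpace MetricCode :=
  measurableSet_isMetricOnNat.standardBorel

/-- The set `ℕ`, to be equipped with the metric `d` (and not with the usual metric of `ℕ`). -/
def Points (_d : MetricCode) : Type := ℕ

/-- The metric space `(ℕ, d)`. -/
noncomputable instance (d : MetricCode) : MetricSpace d.Points where
  dist i j := d.1 i j
  dist_self i := (d.2.1 i i).2 rfl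
  dist_comm := d.2.2.1
  dist_triangle := d.2.2.2
  eq_of_dist_eq_zero {i j} h := (d.2.1 i j).1 h

/-- The Polish metric space `M_d` coded by `d`: the completion of `(ℕ, d)`. -/
abbrev Space (d : MetricCode) : Type := UniformSpace.Completion d.Points

end MetricCode

/-- The Gromov–Hausdorff distance of two metric spaces: the infimum of the Hausdorff distances of
their isometric copies in a common metric space. -/
noncomputable def grHausdorffEDist (M N : Type) [MetricSpace M] [MetricSpace N] : ℝ≥0∞ :=
  ⨅ (X : Type) (_ : MetricSpace X) (ι : M → X) (_ : Isometry ι) (κ : N → X) (_ : Isometry κ),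
    Metric.hausdorffEDist (range ι) (range κ)

/-- The optimal Lipschitz constant `Lip(T) = sup_{x ≠ y} d(T x, T y) / d(x, y)`. -/
noncomputable def lipNorm {M N : Type} [MetricSpace M] [MetricSpace N] (T : M → N) : ℝ≥0∞ :=
  ⨆ (x : M) (y : M) (_ : x ≠ y), edist (T x) (T y) / edist x y

/-- A bijection is bi-Lipschitz if it and its inverse are Lipschitz. -/
def IsBiLipschitz {M N : Type} [MetricSpace M] [MetricSpace N] (T : M ≃ N) : Prop :=
  (∃ K, LipschitzWith K T) ∧ (∃ K, LipschitzWith K T.symm)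

/-- The Lipschitz distance of two metric spaces: the infimum of `log max {Lip(T), Lip(T⁻¹)}` over
all bi-Lipschitz bijections `T` (`∞` if there are none). The logarithm is nonnegative as soon as
the spaces have more than one point. -/
noncomputable def lipschitzEDist (M N : Type) [MetricSpace M] [MetricSpace N] : ℝ≥0∞ :=
  ⨅ (T : M ≃ N) (_ : IsBiLipschitz T),
    ENNReal.ofReal (Real.log (max (lipNorm T) (lipNorm T.symm)).toReal)

/-- The pseudometric `ρ_GH` on `𝓜`: the Gromov–Hausdorff distance of `(ℕ, f)` and `(ℕ, g)`. -/
noncomputable def rhoGH (f g : MetricCode) : ℝ≥0∞ := grHausdorffEDist f.Points g.Points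

/-- The pseudometric `ρ_L` on `𝓜`: the Lipschitz distance of the completions `M_f` and `M_g`. -/
noncomputable def rhoL (f g : MetricCode) : ℝ≥0∞ := lipschitzEDist f.Space g.Space

/-- A subset of a standard Borel space is analytic if it is analytic in a Polish topology that
generates the σ-algebra (this does not depend on the topology). -/
def IsAnalyticSubset {X : Type*} [MeasurableSpace X] [StandardBorelSpace X] (A : Set X) : Prop :=
  ∃ t : TopologicalSpace X, @PolishSpace X t ∧ @BorelSpace X t _ ∧ @AnalyticSet X t A

/-- Analytic pseudometrics, with values in `[0, ∞]`, on a standard Borel space. -/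
structure IsAnalyticPseudometric {X : Type*} [MeasurableSpace X] [StandardBorelSpace X]
    (ρ : X → X → ℝ≥0∞) : Prop where
  self_eq_zero : ∀ x, ρ x x = 0
  symm : ∀ x y, ρ x y = ρ y x
  triangle : ∀ x y z, ρ x z ≤ ρ x y + ρ y z
  analytic : ∀ r : ℝ, 0 < r → IsAnalyticSubset {p : X × X | ρ p.1 p.2 < ENNReal.ofReal r}

/-- `f` is a Borel-uniformly continuous reduction from `ρX` to `ρY`. -/
def IsBorelUnifReduction {X Y : Type*} [MeasurableSpace X] [StandardBorelSpace X]
    [MeasurableSpace Y] [StandardBorelSpace Y]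
    (ρX : X → X → ℝ≥0∞) (ρY : Y → Y → ℝ≥0∞) (f : X → Y) : Prop :=
  Measurable f ∧
    ∀ ε : ℝ, 0 < ε → ∃ δX δY : ℝ, 0 < δX ∧ 0 < δY ∧
      (∀ x y, ρX x y < ENNReal.ofReal δX → ρY (f x) (f y) < ENNReal.ofReal ε) ∧
      (∀ x y, ρY (f x) (f y) < ENNReal.ofReal δY → ρX x y < ENNReal.ofReal ε)

/-- `ρX` is Borel-uniformly continuous reducible to `ρY`. -/
def BorelUnifReducible {X Y : Type*} [MeasurableSpace X] [StandardBorelSpace X]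
    [MeasurableSpace Y] [StandardBorelSpace Y]
    (ρX : X → X → ℝ≥0∞) (ρY : Y → Y → ℝ≥0∞) : Prop :=
  ∃ f : X → Y, IsBorelUnifReduction ρX ρY f

/-- `ρX` and `ρY` are Borel-uniformly continuous bi-reducible. -/
def BorelUnifBireducible {X Y : Type*} [MeasurableSpace X] [StandardBorelSpace X]
    [MeasurableSpace Y] [StandardBorelSpace Y]
    (ρX : X → X → ℝ≥0∞) (ρY : Y → Y → ℝ≥0∞) : Prop :=
  BorelUnifReducible ρX ρY ∧ BorelUnifReducible ρY ρX

/-!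
Both distances are described by families of relations: `ρ_GH (f, g) < r` means that there is a
correspondence of distortion at most `2 t` for some `t < r`, and `ρ_L (f, g) < r` means that there
is a bijection of the completions which is `exp t`-Lipschitz in both directions for some `t < r`.
These relations compose, which gives the triangle inequality, and they are projections of Borel
sets (`isAnalyticPseudometric_of_rel`). For `ρ_L` this holds because a bi-Lipschitz bijection is
coded by two comparable pseudometrics on `ℕ ⊕ ℕ`, the traces of the two metrics on the dense set
generated by both codes (`bilipEquivalent_space_iff`).

Both reductions factor through one construction. To weights `F` on the pairs `(i, s)` of an index
and a scale, `gadgetCode` assigns a metric whose distances between distinct points lie in `[4, 8]`.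
Every pair is repeated infinitely often, so that correspondences can be followed by bijections, and
every copy `x` carries a ray `{x} × ℕ` whose `n`-th level displays the part of `F` between `n` and
`n + 1`, and the scale if it is `n`. Steps in rays are marked by the largest distance, and a
disjoint union of rays is so rigid (`exists_map_of_isRayStep_iff`) that an almost isometric
permutation recovers the unbounded weights up to a small additive error
(`hasCorrespondenceFamily_of_gadget_equiv`). On metrics with distances in `[4, 8]`, small `ρ_GH`,
small `ρ_L` and the existence of an almost isometric permutation are the same thing, since
additive and multiplicative errors are comparable there, correspondences of small distortion are
bijections, and the spaces are complete.

It remains to choose weights. For `ρ_GH` they are the distances `f (i, j)` on all scales. For `ρ_L`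
they are `log (1 + f (i, j) / (2⁻ˢ + 2⁻ᵗ))`: an additive error is a multiplicative error in the
distances blurred at radius `2⁻ˢ + 2⁻ᵗ`. A bi-Lipschitz bijection `T` yields correspondences by
relating `i` and `j` on scale `s` when `T i` is within a small multiple of `2⁻ˢ` of `j`
(`BilipEquivalent.family`); conversely, correspondences on all scales define `T i` as the limit of
the indices related to `i` as `s` tends to infinity (`HasCorrespondenceFamily.bilipEquivalent`).
-/

/-! ### Bi-Lipschitz bijections and dense families -/

/-- There is a bijection `M ≃ N` which is `K`-Lipschitz in both directions. -/
def BilipEquivalent (K : ℝ) (M N : Type) [MetricSpace M] [MetricSpace N] : Prop :=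
  ∃ T : M ≃ N, (∀ x y, dist (T x) (T y) ≤ K * dist x y) ∧ ∀ x y, dist x y ≤ K * dist (T x) (T y)

namespace BilipEquivalent

variable {M N P : Type} [MetricSpace M] [MetricSpace N] [MetricSpace P] {K L : ℝ}

theorem refl (M : Type) [MetricSpace M] : BilipEquivalent 1 M M :=
  ⟨Equiv.refl M, by simp, by simp⟩

theorem symm : BilipEquivalent K M N → BilipEquivalent K N M := by
  rintro ⟨T, h₁, h₂⟩
  exact ⟨T.symm, fun x y => by simpa using h₂ (T.symm x) (T.symm y),
    fun x y => by simpa using h₁ (T.symm x) (T.symm y)⟩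

theorem trans (hK : 0 ≤ K) (hL : 0 ≤ L) :
    BilipEquivalent K M N → BilipEquivalent L N P → BilipEquivalent (K * L) M P := by
  rintro ⟨T, h₁, h₂⟩ ⟨S, h₃, h₄⟩
  refine ⟨T.trans S, fun x y => ?_, fun x y => ?_⟩
  · calc dist (S (T x)) (S (T y)) ≤ L * dist (T x) (T y) := h₃ _ _
      _ ≤ L * (K * dist x y) := by gcongr; exact h₁ _ _
      _ = _ := by ring
  · calc dist x y ≤ K * dist (T x) (T y) := h₂ _ _
      _ ≤ K * (L * dist (S (T x)) (S (T y))) := by gcongr; exact h₄ _ _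
      _ = _ := by simp only [Equiv.trans_apply]; ring

end BilipEquivalent

/-- A Lipschitz function on a dense family extends to the whole space. -/
theorem DenseRange.exists_lipschitz_extension {I X Y : Type*} [MetricSpace X] [MetricSpace Y]
    [CompleteSpace Y] {a : I → X} (ha : DenseRange a) (b : I → Y) {K : ℝ} (hK : 0 ≤ K)
    (hab : ∀ i j, dist (b i) (b j) ≤ K * dist (a i) (a j)) :
    ∃ T : X → Y, (∀ x y, dist (T x) (T y) ≤ K * dist x y) ∧ ∀ i, T (a i) = b i := by
  -- with the pseudometric pulled back along `a`, the family `a` is dense and uniformly inducing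
  let _ : PseudoMetricSpace I := PseudoMetricSpace.induced a inferInstance
  have hau : IsUniformInducing a := ⟨rfl⟩
  have hb : UniformContinuous b :=
    (LipschitzWith.of_dist_le_mul (K := ⟨K, hK⟩) hab).uniformContinuous
  have hT : Continuous ((hau.isDenseInducing ha).extend b) :=
    (uniformContinuous_uniformly_extend hau ha hb).continuous
  have hTa : ∀ i, (hau.isDenseInducing ha).extend b (a i) = b i := fun i =>
    uniformly_extend_of_ind hau ha hb i
  refine ⟨(hau.isDenseInducing ha).extend b, fun x y => ?_, hTa⟩
  refine ha.induction_on₂ (p := fun x y => dist ((hau.isDenseInducing ha).extend b x)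
    ((hau.isDenseInducing ha).extend b y) ≤ K * dist x y) ?_ (fun i j => ?_) x y
  · exact isClosed_le (by fun_prop) (by fun_prop)
  · simpa only [hTa] using hab i j

theorem continuous_of_dist_le_mul {X Y : Type*} [PseudoMetricSpace X] [PseudoMetricSpace Y]
    {T : X → Y} {K : ℝ} (h : ∀ x y, dist (T x) (T y) ≤ K * dist x y) : Continuous T :=
  (LipschitzWith.of_dist_le_mul (K := K.toNNReal) fun x y =>
    (h x y).trans (by gcongr; exact Real.le_coe_toNNReal K)).continuous

theorem bilipEquivalent_of_denseRange {I : Type*} {X Y : Type} [MetricSpace X] [MetricSpace Y]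
    [CompleteSpace X] [CompleteSpace Y] {a : I → X} (ha : DenseRange a) {b : I → Y}
    (hb : DenseRange b) {K : ℝ} (hK : 0 ≤ K)
    (hab : ∀ i j, dist (b i) (b j) ≤ K * dist (a i) (a j))
    (hba : ∀ i j, dist (a i) (a j) ≤ K * dist (b i) (b j)) : BilipEquivalent K X Y := by
  obtain ⟨T, hT, hTa⟩ := ha.exists_lipschitz_extension b hK hab
  obtain ⟨S, hS, hSb⟩ := hb.exists_lipschitz_extension a hK hba
  have hTc := continuous_of_dist_le_mul hT
  have hSc := continuous_of_dist_le_mul hS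
  have hST : ∀ x, S (T x) = x := fun x =>
    ha.induction_on (p := fun x => S (T x) = x) x
      (isClosed_eq (hSc.comp hTc) continuous_id) (fun i => by rw [hTa, hSb])
  have hTS : ∀ y, T (S y) = y := fun y =>
    hb.induction_on (p := fun y => T (S y) = y) y
      (isClosed_eq (hTc.comp hSc) continuous_id) (fun i => by rw [hSb, hTa])
  refine ⟨⟨T, S, hST, hTS⟩, hT, fun x y => ?_⟩
  simpa only [Equiv.coe_fn_mk, hST] using hS (T x) (T y)

/-- Every pseudometric is induced by a map with dense range into a complete metric space. -/
theorem exists_complete_denseRange (I : Type) (p : I → I → ℝ) (h0 : ∀ i, p i i = 0)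
    (hs : ∀ i j, p i j = p j i) (ht : ∀ i j k, p i k ≤ p i j + p j k) :
    ∃ (X : Type) (_ : MetricSpace X) (_ : CompleteSpace X) (e : I → X),
      DenseRange e ∧ ∀ i j, dist (e i) (e j) = p i j := by
  let _ : PseudoMetricSpace I :=
    { dist := p, dist_self := h0, dist_comm := hs, dist_triangle := ht }
  exact ⟨UniformSpace.Completion I, inferInstance, inferInstance, fun i => (i :
    UniformSpace.Completion I), UniformSpace.Completion.denseRange_coe,
    fun i j => UniformSpace.Completion.dist_eq i j⟩

/-! ### The Lipschitz distance -/

section Lipschitz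

variable {M N : Type} [MetricSpace M] [MetricSpace N]

theorem lipNorm_le {T : M → N} {K : ℝ} (h : ∀ x y, dist (T x) (T y) ≤ K * dist x y) :
    lipNorm T ≤ ENNReal.ofReal K := by
  refine iSup_le fun x => iSup_le fun y => iSup_le fun _ => ENNReal.div_le_of_le_mul ?_
  rw [edist_dist, edist_dist, ← ENNReal.ofReal_mul' dist_nonneg]
  exact ENNReal.ofReal_le_ofReal (h x y)

theorem dist_le_of_lipNorm_le {T : M → N} {C : ℝ≥0∞} (hC : C ≠ ∞) (h : lipNorm T ≤ C) (x y : M) :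
    dist (T x) (T y) ≤ C.toReal * dist x y := by
  rcases eq_or_ne x y with rfl | hxy
  · simp
  have h1 : edist (T x) (T y) / edist x y ≤ C :=
    le_trans (le_iSup_of_le x <| le_iSup_of_le y <|
      le_iSup (fun _ : x ≠ y => edist (T x) (T y) / edist x y) hxy) h
  have h2 : edist (T x) (T y) ≤ C * edist x y :=
    (ENNReal.div_le_iff (by simpa using hxy) (edist_ne_top x y)).1 h1
  rw [dist_edist, dist_edist, ← ENNReal.toReal_mul]
  exact ENNReal.toReal_mono (ENNReal.mul_ne_top hC (edist_ne_top x y)) h2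

theorem lipschitzEDist_le {t : ℝ} (ht : 0 ≤ t) (h : BilipEquivalent (Real.exp t) M N) :
    lipschitzEDist M N ≤ ENNReal.ofReal t := by
  obtain ⟨T, h₁, h₂⟩ := h
  have h₂' : ∀ x y, dist (T.symm x) (T.symm y) ≤ Real.exp t * dist x y := fun x y => by
    simpa using h₂ (T.symm x) (T.symm y)
  have hT : IsBiLipschitz T :=
    ⟨⟨⟨Real.exp t, (Real.exp_pos t).le⟩, LipschitzWith.of_dist_le_mul h₁⟩,
      ⟨⟨Real.exp t, (Real.exp_pos t).le⟩, LipschitzWith.of_dist_le_mul h₂'⟩⟩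
  refine iInf₂_le_of_le T hT (ENNReal.ofReal_le_ofReal ?_)
  have hm : (max (lipNorm T) (lipNorm T.symm)).toReal ≤ Real.exp t :=
    ENNReal.toReal_le_of_le_ofReal (Real.exp_pos t).le (max_le (lipNorm_le h₁) (lipNorm_le h₂'))
  -- the maximum vanishes only for subsingleton spaces, where `Real.log 0 = 0` is harmless
  rcases (ENNReal.toReal_nonneg (a := max (lipNorm T) (lipNorm T.symm))).eq_or_lt with h0 | h0
  · rw [← h0, Real.log_zero]
    exact ht
  · exact (Real.log_le_iff_le_exp h0).2 hm

theorem exists_bilipEquivalent_of_lipschitzEDist_lt {r : ℝ}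
    (h : lipschitzEDist M N < ENNReal.ofReal r) :
    ∃ t, 0 ≤ t ∧ t < r ∧ BilipEquivalent (Real.exp t) M N := by
  obtain ⟨T, h⟩ := iInf_lt_iff.1 h
  obtain ⟨⟨⟨K, hK⟩, ⟨L, hL⟩⟩, h⟩ := iInf_lt_iff.1 h
  set m := max (lipNorm T) (lipNorm T.symm) with hm
  have hr : 0 < r := ENNReal.ofReal_pos.1 (zero_le.trans_lt h)
  have hmtop : m ≠ ∞ :=
    (max_lt ((lipNorm_le fun x y => hK.dist_le_mul x y).trans_lt ENNReal.ofReal_lt_top)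
      ((lipNorm_le fun x y => hL.dist_le_mul x y).trans_lt ENNReal.ofReal_lt_top)).ne
  have hexp : m.toReal ≤ Real.exp (max 0 (Real.log m.toReal)) :=
    (Real.le_exp_log _).trans (Real.exp_le_exp.2 (le_max_right _ _))
  refine ⟨max 0 (Real.log m.toReal), le_max_left _ _,
    max_lt hr ((ENNReal.ofReal_lt_ofReal_iff hr).1 h), T, fun x y => ?_, fun x y => ?_⟩
  · exact (dist_le_of_lipNorm_le hmtop (le_max_left _ _) x y).trans (by gcongr)
  · have := dist_le_of_lipNorm_le hmtop (le_max_right _ _) (T x) (T y)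
    simp only [Equiv.symm_apply_apply] at this
    exact this.trans (by gcongr)

end Lipschitz

/-! ### Correspondences and the Gromov–Hausdorff distance -/

/-- A relation between `ℕ` and `ℕ` whose projections to both sides are onto. -/
def IsCorrespondence (R : ℕ → ℕ → Prop) : Prop :=
  (∀ i, ∃ j, R i j) ∧ ∀ j, ∃ i, R i j

/-- There is a correspondence of distortion at most `c` between `(ℕ, f)` and `(ℕ, g)`. -/
def HasCorrespondence (c : ℝ) (f g : MetricCode) : Prop :=
  ∃ R : ℕ → ℕ → Prop, IsCorrespondence R ∧
    ∀ i j i' j', R i j → R i' j' → |f.1 i i' - g.1 j j'| ≤ c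

namespace HasCorrespondence

variable {f g h : MetricCode} {c c' : ℝ}

theorem refl (f : MetricCode) : HasCorrespondence 0 f f :=
  ⟨Eq, ⟨fun i => ⟨i, rfl⟩, fun i => ⟨i, rfl⟩⟩, by rintro i _ i' _ rfl rfl; simp⟩

theorem symm : HasCorrespondence c f g → HasCorrespondence c g f := by
  rintro ⟨R, ⟨h₁, h₂⟩, h⟩
  exact ⟨fun i j => R j i, ⟨h₂, h₁⟩, fun i j i' j' hi hj => by
    rw [abs_sub_comm]; exact h j i j' i' hi hj⟩

theorem trans : HasCorrespondence c f g → HasCorrespondence c' g h →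
    HasCorrespondence (c + c') f h := by
  rintro ⟨R, ⟨hR₁, hR₂⟩, hR⟩ ⟨S, ⟨hS₁, hS₂⟩, hS⟩
  refine ⟨fun i k => ∃ j, R i j ∧ S j k, ⟨fun i => ?_, fun k => ?_⟩, ?_⟩
  · obtain ⟨j, hj⟩ := hR₁ i
    obtain ⟨k, hk⟩ := hS₁ j
    exact ⟨k, j, hj, hk⟩
  · obtain ⟨j, hj⟩ := hS₂ k
    obtain ⟨i, hi⟩ := hR₂ j
    exact ⟨i, j, hi, hj⟩
  · rintro i k i' k' ⟨j, h₁, h₂⟩ ⟨j', h₁', h₂'⟩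
    exact (abs_sub_le _ (g.1 j j') _).trans (add_le_add (hR _ _ _ _ h₁ h₁') (hS _ _ _ _ h₂ h₂'))

end HasCorrespondence

theorem rhoGH_lt {f g : MetricCode} {t r : ℝ} (ht : 0 ≤ t) (htr : t < r)
    (h : HasCorrespondence (2 * t) f g) : rhoGH f g < ENNReal.ofReal r := by
  obtain ⟨R, ⟨hR₁, hR₂⟩, hR⟩ := h
  -- gluing along a correspondence needs a positive distance, and `t` may be `0`
  obtain ⟨s, hts, hsr⟩ := exists_between htr
  have hs : 0 < s := ht.trans_lt hts
  refine lt_of_le_of_lt ?_ ((ENNReal.ofReal_lt_ofReal_iff (hs.trans hsr)).2 hsr)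
  let Z := {p : ℕ × ℕ // R p.1 p.2}
  obtain ⟨j₀, hj₀⟩ := hR₁ 0
  have : Nonempty Z := ⟨⟨(0, j₀), hj₀⟩⟩
  let Φ : Z → f.Points := fun z => z.1.1
  let Ψ : Z → g.Points := fun z => z.1.2
  have H : ∀ p q, |dist (Φ p) (Φ q) - dist (Ψ p) (Ψ q)| ≤ 2 * s := fun p q =>
    (hR _ _ _ _ p.2 q.2).trans (by linarith)
  let _ : MetricSpace (f.Points ⊕ g.Points) := Metric.glueMetricApprox Φ Ψ s hs H
  have hinl : Isometry (Sum.inl : f.Points → f.Points ⊕ g.Points) := Isometry.of_dist_eq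
    fun _ _ => rfl
  have hinr : Isometry (Sum.inr : g.Points → f.Points ⊕ g.Points) := Isometry.of_dist_eq
    fun _ _ => rfl
  have hd : ∀ z : Z, edist (Sum.inl (Φ z) : f.Points ⊕ g.Points) (Sum.inr (Ψ z)) ≤
      ENNReal.ofReal s := fun z => by
    rw [edist_dist]
    exact ENNReal.ofReal_le_ofReal (Metric.glueDist_glued_points Φ Ψ s z).le
  refine iInf_le_of_le (f.Points ⊕ g.Points) <| iInf_le_of_le inferInstance <|
    iInf₂_le_of_le Sum.inl hinl <| iInf₂_le_of_le Sum.inr hinr <|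
      Metric.hausdorffEDist_le_of_mem_edist ?_ ?_
  · rintro _ ⟨i, rfl⟩
    obtain ⟨j, hj⟩ := hR₁ i
    exact ⟨_, ⟨j, rfl⟩, hd ⟨(i, j), hj⟩⟩
  · rintro _ ⟨j, rfl⟩
    obtain ⟨i, hi⟩ := hR₂ j
    exact ⟨_, ⟨i, rfl⟩, by rw [edist_comm]; exact hd ⟨(i, j), hi⟩⟩

theorem exists_hasCorrespondence_of_rhoGH_lt {f g : MetricCode} {r : ℝ}
    (h : rhoGH f g < ENNReal.ofReal r) :
    ∃ t, 0 ≤ t ∧ t < r ∧ HasCorrespondence (2 * t) f g := by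
  unfold rhoGH grHausdorffEDist at h
  simp only [iInf_lt_iff] at h
  obtain ⟨X, _, ι, hι, κ, hκ, h⟩ := h
  have hr : 0 < r := ENNReal.ofReal_pos.1 (zero_le.trans_lt h)
  obtain ⟨s, hs, hsr⟩ := ENNReal.lt_iff_exists_real_btwn.1 h
  have hsr' : s < r := (ENNReal.ofReal_lt_ofReal_iff hr).1 hsr.2
  have hd : ∀ x y : X, edist x y < ENNReal.ofReal s → dist x y ≤ s := fun x y hxy =>
    (edist_lt_ofReal.1 hxy).le
  refine ⟨s, hs, hsr', fun i j => edist (ι i) (κ j) < ENNReal.ofReal s, ⟨fun i => ?_, fun j => ?_⟩,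
    fun i j i' j' h₁ h₂ => ?_⟩
  · obtain ⟨_, ⟨j, rfl⟩, hj⟩ := Metric.exists_edist_lt_of_hausdorffEDist_lt (mem_range_self i) hsr.1
    exact ⟨j, hj⟩
  · rw [Metric.hausdorffEDist_comm] at hsr
    obtain ⟨_, ⟨i, rfl⟩, hi⟩ := Metric.exists_edist_lt_of_hausdorffEDist_lt (mem_range_self j) hsr.1
    exact ⟨i, (edist_comm (ι i) (κ j)).trans_lt hi⟩
  · have e₁ : f.1 i i' = dist (ι i) (ι i') := (hι.dist_eq i i').symm
    have e₂ : g.1 j j' = dist (κ j) (κ j') := (hκ.dist_eq j j').symm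
    rw [e₁, e₂, abs_le]
    have := hd _ _ h₁
    have := hd _ _ h₂
    have := dist_triangle4 (ι i) (κ j) (κ j') (ι i')
    have := dist_triangle4 (κ j) (ι i) (ι i') (κ j')
    have := dist_comm (κ j) (ι i)
    have := dist_comm (κ j') (ι i')
    constructor <;> linarith

/-! ### Analytic pseudometrics from parametrized closeness relations -/

/-- If `ρ` is described by relations that are reflexive at `0`, symmetric and additive, then it is a
pseudometric; if moreover the relations are jointly projections of one Borel set, it is analytic.
The parameter `t` is one of the projected coordinates, so its range need not be countable. -/
theorem isAnalyticPseudometric_of_rel {X Z : Type*} [MeasurableSpace X] [StandardBorelSpace X]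
    [MeasurableSpace Z] [StandardBorelSpace Z] {ρ : X → X → ℝ≥0∞} (Rel : ℝ → X → X → Prop)
    (hlt : ∀ x y r, 0 < r → (ρ x y < ENNReal.ofReal r ↔ ∃ t, 0 ≤ t ∧ t < r ∧ Rel t x y))
    (hrefl : ∀ x, Rel 0 x x) (hsymm : ∀ t x y, Rel t x y → Rel t y x)
    (htrans : ∀ s t x y z, 0 ≤ s → 0 ≤ t → Rel s x y → Rel t y z → Rel (s + t) x z)
    {B : Set (((X × X) × Z) × ℝ)} (hB : MeasurableSet B)
    (hRel : ∀ t x y, Rel t x y ↔ ∃ z, (((x, y), z), t) ∈ B) : IsAnalyticPseudometric ρ := by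
  have hle : ∀ {a b : ℝ≥0∞}, (∀ r : ℝ, 0 < r → b < ENNReal.ofReal r → a < ENNReal.ofReal r) →
      a ≤ b := by
    intro a b h
    refine le_of_forall_gt_imp_ge_of_dense fun c hc => ?_
    obtain ⟨r, -, hbr, hrc⟩ := ENNReal.lt_iff_exists_real_btwn.1 hc
    exact (h r (ENNReal.ofReal_pos.1 (zero_le.trans_lt hbr)) hbr).le.trans hrc.le
  refine ⟨fun x => ?_, ?_, fun x y z => ?_, fun r hr => ?_⟩
  · refine le_antisymm (hle fun r hr _ => (hlt x x r hr).2 ⟨0, le_rfl, hr, hrefl x⟩) zero_le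
  · have : ∀ x y, ρ x y ≤ ρ y x := fun x y => hle fun r hr h => by
      obtain ⟨t, h0, h1, h2⟩ := (hlt y x r hr).1 h
      exact (hlt x y r hr).2 ⟨t, h0, h1, hsymm _ _ _ h2⟩
    exact fun x y => le_antisymm (this x y) (this y x)
  · refine ENNReal.le_of_forall_pos_le_add fun ε hε hfin => ?_
    obtain ⟨hxy, hyz⟩ := ENNReal.add_lt_top.1 hfin
    have key : ∀ {u : ℝ≥0∞}, u < ∞ → ∃ a : ℝ, 0 < a ∧ u < ENNReal.ofReal a ∧
        a = u.toReal + ε / 2 := fun {u} hu => by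
      have hpos : (0 : ℝ) < u.toReal + ε / 2 := by
        have := ENNReal.toReal_nonneg (a := u)
        positivity
      refine ⟨_, hpos, (ENNReal.lt_ofReal_iff_toReal_lt hu.ne).2 ?_, rfl⟩
      have : (0 : ℝ) < ε := hε
      linarith
    obtain ⟨a, ha0, ha, ha'⟩ := key hxy
    obtain ⟨b, hb0, hb, hb'⟩ := key hyz
    obtain ⟨s, hs0, hsa, hs⟩ := (hlt x y a ha0).1 ha
    obtain ⟨t, ht0, htb, ht⟩ := (hlt y z b hb0).1 hb
    have := (hlt x z (a + b) (by positivity)).2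
      ⟨s + t, by positivity, by linarith, htrans s t x y z hs0 ht0 hs ht⟩
    refine this.le.trans ?_
    rw [ha', hb', show (ρ x y).toReal + ε / 2 + ((ρ y z).toReal + ε / 2) =
      (ρ x y).toReal + (ρ y z).toReal + ε by ring, ENNReal.ofReal_add (by positivity) ε.coe_nonneg,
      ENNReal.ofReal_add (by positivity) (by positivity), ENNReal.ofReal_toReal hxy.ne,
      ENNReal.ofReal_toReal hyz.ne, ENNReal.ofReal_coe_nnreal]
  · obtain ⟨τ, hτB, hτP⟩ := StandardBorelSpace.polish (α := X × X)
    refine ⟨τ, hτP, hτB, ?_⟩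
    have hC : MeasurableSet (B ∩ {p | 0 ≤ p.2 ∧ p.2 < r}) :=
      hB.inter ((measurableSet_le measurable_const measurable_snd).inter
        (measurableSet_lt measurable_snd measurable_const))
    convert hC.analyticSet_image (f := fun p : ((X × X) × Z) × ℝ => p.1.1)
      (measurable_fst.comp measurable_fst) using 1
    ext ⟨x, y⟩
    simp only [mem_ofPred_eq, hlt x y r hr, hRel, mem_image, mem_inter_iff]
    constructor
    · rintro ⟨t, h0, h1, z, hz⟩
      exact ⟨_, ⟨hz, h0, h1⟩, rfl⟩
    · rintro ⟨⟨⟨⟨x', y'⟩, z⟩, t⟩, ⟨hz, h0, h1⟩, h⟩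
      obtain ⟨rfl, rfl⟩ := Prod.mk.inj h
      exact ⟨t, h0, h1, z, hz⟩

/-! ### Analyticity of the two pseudometrics -/

theorem MetricCode.measurable_apply (i j : ℕ) : Measurable fun f : MetricCode => f.1 i j := by
  have h : Measurable fun d : ℕ → ℕ → ℝ => d i j :=
    (measurable_pi_apply j).comp (measurable_pi_apply i)
  exact h.comp measurable_subtype_coe

theorem isAnalyticPseudometric_rhoGH : IsAnalyticPseudometric rhoGH := by
  let B : Set (((MetricCode × MetricCode) × (ℕ → ℕ → Bool)) × ℝ) :=
    {p | ((∀ i, ∃ j, p.1.2 i j = true) ∧ ∀ j, ∃ i, p.1.2 i j = true) ∧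
      ∀ i j i' j', p.1.2 i j = true → p.1.2 i' j' = true →
        |p.1.1.1.1 i i' - p.1.1.2.1 j j'| ≤ 2 * p.2}
  have hR : ∀ i j, Measurable fun p : ((MetricCode × MetricCode) × (ℕ → ℕ → Bool)) × ℝ =>
      p.1.2 i j = true := fun i j =>
    measurableSet_setOfPred.1 (measurableSet_eq_fun ((measurable_pi_apply j).comp
      ((measurable_pi_apply i).comp (measurable_snd.comp measurable_fst))) measurable_const)
  have hB : MeasurableSet B := by
    refine measurableSet_setOfPred.2
      (((Measurable.forall fun i => Measurable.exists fun j => hR i j).and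
      (Measurable.forall fun j => Measurable.exists fun i => hR i j)).and
      (Measurable.forall fun i => Measurable.forall fun j => Measurable.forall fun i' =>
        Measurable.forall fun j' => (hR i j).imp ((hR i' j').imp ?_)))
    refine measurableSet_setOfPred.1 (measurableSet_le ?_ (measurable_const.mul measurable_snd))
    exact (((MetricCode.measurable_apply i i').comp
      (measurable_fst.comp (measurable_fst.comp measurable_fst))).sub
      ((MetricCode.measurable_apply j j').comp
        (measurable_snd.comp (measurable_fst.comp measurable_fst)))).abs
  refine isAnalyticPseudometric_of_rel (fun t f g => HasCorrespondence (2 * t) f g)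
    (fun f g r _ => ⟨exists_hasCorrespondence_of_rhoGH_lt, fun ⟨t, h0, h1, h⟩ => rhoGH_lt h0 h1 h⟩)
    (fun f => by simpa using HasCorrespondence.refl f) (fun t f g h => h.symm)
    (fun s t f g h _ _ h₁ h₂ => by rw [mul_add]; exact h₁.trans h₂) hB fun t f g => ?_
  constructor
  · rintro ⟨R, hR, h⟩
    classical
    exact ⟨fun i j => decide (R i j), by simpa [B, IsCorrespondence] using ⟨hR, h⟩⟩
  · rintro ⟨z, hz, h⟩
    exact ⟨fun i j => z i j = true, hz, h⟩

/-- Real functions of two variables from `ℕ ⊕ ℕ`. -/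
abbrev PairFunctions : Type := ℕ ⊕ ℕ → ℕ ⊕ ℕ → ℝ

/-- `p` is a pseudometric on `ℕ ⊕ ℕ`. -/
def IsPseudometricOnSum (p : ℕ ⊕ ℕ → ℕ ⊕ ℕ → ℝ) : Prop :=
  (∀ x, p x x = 0) ∧ (∀ x y, p x y = p y x) ∧ ∀ x y z, p x z ≤ p x y + p y z

/-- `p` restricts to `f` along `e`, and the image of `e` is `p`-dense. -/
def ExtendsDensely (f : MetricCode) (e : ℕ → ℕ ⊕ ℕ) (p : ℕ ⊕ ℕ → ℕ ⊕ ℕ → ℝ) : Prop :=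
  (∀ i j, p (e i) (e j) = f.1 i j) ∧ ∀ x, ∀ m : ℕ, ∃ i, p x (e i) < 1 / ((m : ℝ) + 1)

/-- The image of `i : ℕ` in the completion of `(ℕ, f)`. -/
noncomputable def MetricCode.point (f : MetricCode) (i : ℕ) : f.Space :=
  UniformSpace.Completion.coe' (α := f.Points) i

theorem MetricCode.denseRange_point (f : MetricCode) : DenseRange f.point :=
  UniformSpace.Completion.denseRange_coe (α := f.Points)

theorem MetricCode.dist_point (f : MetricCode) (i j : ℕ) :
    dist (f.point i) (f.point j) = f.1 i j :=
  UniformSpace.Completion.dist_eq (α := f.Points) i j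

theorem ExtendsDensely.bilipEquivalent {f : MetricCode} {e : ℕ → ℕ ⊕ ℕ} {p : ℕ ⊕ ℕ → ℕ ⊕ ℕ → ℝ}
    (h : ExtendsDensely f e p) {X : Type} [MetricSpace X] [CompleteSpace X] {a : ℕ ⊕ ℕ → X}
    (ha : DenseRange a) (hap : ∀ x y, dist (a x) (a y) = p x y) : BilipEquivalent 1 f.Space X := by
  refine bilipEquivalent_of_denseRange f.denseRange_point (b := fun i => a (e i)) ?_ zero_le_one
    (fun i j => ?_) (fun i j => ?_)
  · -- approximate by the dense family `a` first, and then by the image of `e`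
    refine Metric.denseRange_iff.2 fun y r hr => ?_
    obtain ⟨x, hx⟩ := ha.exists_dist_lt y (half_pos hr)
    obtain ⟨m, hm⟩ := exists_nat_one_div_lt (half_pos hr)
    obtain ⟨i, hi⟩ := h.2 x m
    rw [← hap] at hi
    exact ⟨i, by linarith [dist_triangle y (a x) (a (e i))]⟩
  · rw [hap, h.1, f.dist_point, one_mul]
  · rw [hap, h.1, f.dist_point, one_mul]

/-- A bi-Lipschitz bijection of the completions is coded by its effect on the countable dense set
generated by the two codes: a pair of comparable pseudometrics on `ℕ ⊕ ℕ`. -/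
theorem bilipEquivalent_space_iff {K : ℝ} (hK : 0 ≤ K) (f g : MetricCode) :
    BilipEquivalent K f.Space g.Space ↔ ∃ p q : ℕ ⊕ ℕ → ℕ ⊕ ℕ → ℝ,
      (IsPseudometricOnSum p ∧ IsPseudometricOnSum q) ∧
      (ExtendsDensely f Sum.inl p ∧ ExtendsDensely g Sum.inr q) ∧
      ∀ x y, q x y ≤ K * p x y ∧ p x y ≤ K * q x y := by
  constructor
  · rintro ⟨T, h₁, h₂⟩
    let a : ℕ ⊕ ℕ → f.Space := Sum.elim f.point fun j => T.symm (g.point j)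
    refine ⟨fun x y => dist (a x) (a y), fun x y => dist (T (a x)) (T (a y)),
      ⟨⟨fun x => dist_self _, fun x y => dist_comm _ _, fun x y z => dist_triangle _ _ _⟩,
        ⟨fun x => dist_self _, fun x y => dist_comm _ _, fun x y z => dist_triangle _ _ _⟩⟩,
      ⟨⟨fun i j => f.dist_point i j, fun x m => ?_⟩, ⟨fun i j => ?_, fun x m => ?_⟩⟩,
      fun x y => ⟨h₁ _ _, h₂ _ _⟩⟩
    · exact f.denseRange_point.exists_dist_lt (a x) Nat.one_div_pos_of_nat
    · simp only [a, Sum.elim_inr, Equiv.apply_symm_apply]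
      exact g.dist_point i j
    · simp only [a, Sum.elim_inr, Equiv.apply_symm_apply]
      exact g.denseRange_point.exists_dist_lt _ Nat.one_div_pos_of_nat
  · rintro ⟨p, q, ⟨hp, hq⟩, ⟨hf, hg⟩, hpq⟩
    obtain ⟨X, _, _, a, ha, hap⟩ := exists_complete_denseRange _ p hp.1 hp.2.1 hp.2.2
    obtain ⟨Y, _, _, b, hb, hbq⟩ := exists_complete_denseRange _ q hq.1 hq.2.1 hq.2.2
    have hXY : BilipEquivalent K X Y := bilipEquivalent_of_denseRange ha hb hK
      (fun x y => by rw [hap, hbq]; exact (hpq x y).1)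
      (fun x y => by rw [hap, hbq]; exact (hpq x y).2)
    have := ((hf.bilipEquivalent ha hap).trans zero_le_one hK hXY).trans (by linarith) zero_le_one
      (hg.bilipEquivalent hb hbq).symm
    simpa using this

/-- Two codes, two functions that may code a bi-Lipschitz bijection of the completions, and the
logarithm of its constant. -/
abbrev LipschitzWitness : Type :=
  ((MetricCode × MetricCode) × (PairFunctions × PairFunctions)) × ℝ

theorem isAnalyticPseudometric_rhoL : IsAnalyticPseudometric rhoL := by
  let B : Set (LipschitzWitness) :=
    {w | (IsPseudometricOnSum w.1.2.1 ∧ IsPseudometricOnSum w.1.2.2) ∧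
      (ExtendsDensely w.1.1.1 Sum.inl w.1.2.1 ∧ ExtendsDensely w.1.1.2 Sum.inr w.1.2.2) ∧
      ∀ x y, w.1.2.2 x y ≤ Real.exp w.2 * w.1.2.1 x y ∧ w.1.2.1 x y ≤ Real.exp w.2 * w.1.2.2 x y}
  have hp : ∀ x y, Measurable fun w : LipschitzWitness => w.1.2.1 x y := by
    fun_prop
  have hq : ∀ x y, Measurable fun w : LipschitzWitness => w.1.2.2 x y := by
    fun_prop
  have hf : ∀ i j, Measurable fun w : LipschitzWitness => w.1.1.1.1 i j :=
    fun i j => (MetricCode.measurable_apply i j).comp (by fun_prop)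
  have hg : ∀ i j, Measurable fun w : LipschitzWitness => w.1.1.2.1 i j :=
    fun i j => (MetricCode.measurable_apply i j).comp (by fun_prop)
  have hps : ∀ φ : LipschitzWitness → PairFunctions,
      (∀ x y, Measurable fun w => φ w x y) → Measurable fun w => IsPseudometricOnSum (φ w) := by
    intro φ hφ
    refine (Measurable.forall fun x => ?_).and ((Measurable.forall fun x =>
      Measurable.forall fun y => ?_).and (Measurable.forall fun x => Measurable.forall fun y =>
        Measurable.forall fun z => ?_))
    · exact measurableSet_setOfPred.1 (measurableSet_eq_fun (hφ x x) measurable_const)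
    · exact measurableSet_setOfPred.1 (measurableSet_eq_fun (hφ x y) (hφ y x))
    · exact measurableSet_setOfPred.1 (measurableSet_le (hφ x z) ((hφ x y).add (hφ y z)))
  have hde : ∀ (c : LipschitzWitness → MetricCode) (e : ℕ → ℕ ⊕ ℕ)
      (φ : LipschitzWitness → PairFunctions),
      (∀ i j, Measurable fun w => (c w).1 i j) → (∀ x y, Measurable fun w => φ w x y) →
      Measurable fun w => ExtendsDensely (c w) e (φ w) := by
    intro c e φ hc hφ
    refine Measurable.and (Measurable.forall fun i => Measurable.forall fun j => ?_)
      (Measurable.forall fun x => Measurable.forall fun m => Measurable.exists fun i => ?_)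
    · exact measurableSet_setOfPred.1 (measurableSet_eq_fun (hφ _ _) (hc i j))
    · exact measurableSet_setOfPred.1 (measurableSet_lt (hφ _ _) measurable_const)
  have hB : MeasurableSet B := by
    refine measurableSet_setOfPred.2 (((hps _ hp).and (hps _ hq)).and
      (((hde _ _ _ hf hp).and (hde _ _ _ hg hq)).and
      (Measurable.forall fun x => Measurable.forall fun y => .and ?_ ?_)))
    · exact measurableSet_setOfPred.1 (measurableSet_le (hq x y)
        ((Real.measurable_exp.comp measurable_snd).mul (hp x y)))
    · exact measurableSet_setOfPred.1 (measurableSet_le (hp x y)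
        ((Real.measurable_exp.comp measurable_snd).mul (hq x y)))
  have : StandardBorelSpace (PairFunctions × PairFunctions) := StandardBorelSpace.prod
  refine isAnalyticPseudometric_of_rel
    (fun t f g => BilipEquivalent (Real.exp t) f.Space g.Space)
    (fun f g r hr => ⟨exists_bilipEquivalent_of_lipschitzEDist_lt, fun ⟨t, h0, h1, h⟩ =>
      (lipschitzEDist_le h0 h).trans_lt ((ENNReal.ofReal_lt_ofReal_iff hr).2 h1)⟩)
    (fun f => by simpa using BilipEquivalent.refl f.Space) (fun t f g h => h.symm)
    (fun s t f g h _ _ h₁ h₂ => by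
      rw [Real.exp_add]; exact h₁.trans (Real.exp_pos s).le (Real.exp_pos t).le h₂) hB
    fun t f g => ?_
  rw [bilipEquivalent_space_iff (Real.exp_pos t).le]
  exact ⟨fun ⟨p, q, h⟩ => ⟨(p, q), h⟩, fun ⟨z, h⟩ => ⟨z.1, z.2, h⟩⟩

/-! ### Families of correspondences -/

/-- For every `s` there is a correspondence `R s` of `ℕ` with itself such that any two pairs of
indices related at levels `s` and `t` have `F`- and `G`-values differing by at most `ε`. -/
def HasCorrespondenceFamily (ε : ℝ) (F G : ℕ × ℕ → ℕ × ℕ → ℝ) : Prop :=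
  ∃ R : ℕ → ℕ → ℕ → Prop, (∀ s, IsCorrespondence (R s)) ∧ ∀ s t i j i' j', R s i j → R t i' j' →
    |F (i, s) (i', t) - G (j, s) (j', t)| ≤ ε

/-- A surjection of a countable type becomes the projection of a product when multiplied by `ℕ`. -/
theorem Function.Surjective.exists_equiv_prod_nat {Z U : Type*} [Countable Z] {p : Z → U}
    (hp : Function.Surjective p) : ∃ e : Z × ℕ ≃ U × ℕ, ∀ z, (e z).1 = p z.1 := by
  -- the fibres of the projection of `Z × ℕ` to `U` are countably infinite
  have hfib : ∀ u, Nonempty ({z : Z × ℕ // p z.1 = u} ≃ ℕ) := fun u => by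
    obtain ⟨z, hz⟩ := hp u
    have : Infinite {z : Z × ℕ // p z.1 = u} := Infinite.of_injective (fun n => ⟨(z, n), hz⟩)
      fun m n h => (Prod.mk.inj (Subtype.mk.inj h)).2
    exact nonempty_equiv_of_countable
  let e₁ : Z × ℕ ≃ Σ u, {z : Z × ℕ // p z.1 = u} :=
    (Equiv.sigmaFiberEquiv fun z : Z × ℕ => p z.1).symm
  let e₂ : (Σ u, {z : Z × ℕ // p z.1 = u}) ≃ Σ _ : U, ℕ :=
    Equiv.sigmaCongrRight fun u => (hfib u).some
  exact ⟨(e₁.trans e₂).trans (Equiv.sigmaEquivProd U ℕ), fun z => rfl⟩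

/-- With every index repeated infinitely often, correspondences can be followed by a bijection. -/
theorem HasCorrespondenceFamily.exists_equiv {ε : ℝ} {F G : ℕ × ℕ → ℕ × ℕ → ℝ}
    (h : HasCorrespondenceFamily ε F G) :
    ∃ φ : (ℕ × ℕ) × ℕ ≃ (ℕ × ℕ) × ℕ, (∀ x, (φ x).1.2 = x.1.2) ∧
      ∀ x y, |F x.1 y.1 - G (φ x).1 (φ y).1| ≤ ε := by
  obtain ⟨R, hR, hFG⟩ := h
  -- the graph of the family projects onto the index-scale pairs of either side
  let Z := {z : ℕ × ℕ × ℕ // R z.2.2 z.1 z.2.1}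
  have h₁ : Function.Surjective fun z : Z => (z.1.1, z.1.2.2) := fun ⟨i, s⟩ => by
    obtain ⟨j, hj⟩ := (hR s).1 i
    exact ⟨⟨(i, j, s), hj⟩, rfl⟩
  have h₂ : Function.Surjective fun z : Z => (z.1.2.1, z.1.2.2) := fun ⟨j, s⟩ => by
    obtain ⟨i, hi⟩ := (hR s).2 j
    exact ⟨⟨(i, j, s), hi⟩, rfl⟩
  obtain ⟨e₁, he₁⟩ := h₁.exists_equiv_prod_nat
  obtain ⟨e₂, he₂⟩ := h₂.exists_equiv_prod_nat
  have hφ : ∀ x, ∃ z : Z, x.1 = (z.1.1, z.1.2.2) ∧ (e₂ (e₁.symm x)).1 = (z.1.2.1, z.1.2.2) :=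
    fun x => ⟨(e₁.symm x).1, by rw [← he₁, e₁.apply_symm_apply], he₂ _⟩
  refine ⟨e₁.symm.trans e₂, fun x => ?_, fun x y => ?_⟩
  · obtain ⟨z, hz, hz'⟩ := hφ x
    simp only [Equiv.trans_apply, hz, hz']
  · obtain ⟨z, hz, hz'⟩ := hφ x
    obtain ⟨w, hw, hw'⟩ := hφ y
    simp only [Equiv.trans_apply, hz, hz', hw, hw']
    exact hFG _ _ _ _ _ _ z.2 w.2

/-! ### Disjoint unions of rays are rigid -/

/-- The points `p` and `q` are consecutive in one of the rays `{x} × ℕ`. -/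
def IsRayStep {X : Type*} (p q : X × ℕ) : Prop :=
  p.1 = q.1 ∧ (p.2 + 1 = q.2 ∨ q.2 + 1 = p.2)

theorem IsRayStep.symm {X : Type*} {p q : X × ℕ} (h : IsRayStep p q) : IsRayStep q p :=
  ⟨h.1.symm, h.2.symm⟩

theorem IsRayStep.ne {X : Type*} {p q : X × ℕ} (h : IsRayStep p q) : p ≠ q := by
  rintro rfl
  have := h.2
  omega

/-- An automorphism of a disjoint union of rays permutes the rays and preserves the position in
them: the initial points are the only ones with a single neighbour. -/
theorem exists_map_of_isRayStep_iff {X : Type*} (π : X × ℕ ≃ X × ℕ)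
    (h : ∀ p q, IsRayStep p q ↔ IsRayStep (π p) (π q)) :
    ∃ φ : X → X, Function.Surjective φ ∧ ∀ x n, π (x, n) = (φ x, n) := by
  have key : ∀ σ : X × ℕ ≃ X × ℕ, (∀ p q, IsRayStep p q ↔ IsRayStep (σ p) (σ q)) →
      ∃ φ : X → X, ∀ x n, σ (x, n) = (φ x, n) := by
    intro σ hσ
    refine ⟨fun x => (σ (x, 0)).1, fun x n => ?_⟩
    induction n using Nat.strong_induction_on with
    | _ n ih =>
      match n, ih with
      | 0, _ =>
        rcases hp : σ (x, 0) with ⟨y, _ | m⟩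
        · exact Prod.ext (by simp [hp]) rfl
        · -- a point of positive level has two neighbours, but `(x, 0)` has only one
          exfalso
          have nbr : ∀ q, IsRayStep (y, m + 1) q → σ.symm q = (x, 1) := fun q hq => by
            rw [← hp, ← σ.apply_symm_apply q, ← hσ] at hq
            exact Prod.ext hq.1.symm (by have := hq.2; simp only at this; omega)
          have := (nbr (y, m) ⟨rfl, Or.inr rfl⟩).trans (nbr (y, m + 2) ⟨rfl, Or.inl rfl⟩).symm
          have := (Prod.mk.inj (σ.symm.injective this)).2
          omega
      | n + 1, ih =>
        have h₁ := (hσ (x, n) (x, n + 1)).1 ⟨rfl, Or.inl rfl⟩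
        rw [ih n (Nat.lt_succ_self n)] at h₁
        refine Prod.ext h₁.1.symm (h₁.2.resolve_right fun h₂ => ?_).symm
        -- otherwise `(x, n + 1)` and `(x, n - 1)` have the same image
        obtain ⟨m, rfl⟩ : ∃ m, n = m + 1 := ⟨_, h₂.symm⟩
        have h₃ : σ (x, m + 1 + 1) = σ (x, m) := by
          rw [ih m (by omega)]
          exact Prod.ext h₁.1.symm (by simpa using h₂)
        have := (Prod.mk.inj (σ.injective h₃)).2
        omega
  obtain ⟨φ, hφ⟩ := key π h
  obtain ⟨ψ, hψ⟩ := key π.symm fun p q => by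
    simpa using (h (π.symm p) (π.symm q)).symm
  refine ⟨φ, fun y => ⟨ψ y, ?_⟩, hφ⟩
  have := π.apply_symm_apply (y, 0)
  rw [hψ, hφ] at this
  exact (Prod.mk.inj this).1

/-! ### Coding a weighted structure by a bounded, uniformly discrete metric -/

/-- The part of `a` above `n`, truncated at `1`; the values for all `n : ℕ` determine `a ≥ 0`. -/
noncomputable def truncation (a : ℝ) (n : ℕ) : ℝ := max 0 (min 1 (a - n))

theorem truncation_nonneg (a : ℝ) (n : ℕ) : 0 ≤ truncation a n := le_max_left _ _

theorem truncation_le_one (a : ℝ) (n : ℕ) : truncation a n ≤ 1 :=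
  max_le zero_le_one (min_le_left _ _)

theorem abs_truncation_sub_le (a b : ℝ) (n : ℕ) :
    |truncation a n - truncation b n| ≤ |a - b| := by
  have h₁ := abs_max_sub_max_le_abs (min 1 (a - n)) (min 1 (b - n)) 0
  have h₂ := abs_min_sub_min_le_max 1 (a - n) 1 (b - n)
  rw [sub_self, abs_zero, max_eq_right (abs_nonneg _), sub_sub_sub_cancel_right] at h₂
  rw [max_comm, max_comm _ (0 : ℝ)] at h₁
  exact h₁.trans h₂

theorem abs_sub_le_of_truncation {a b η : ℝ} (ha : 0 ≤ a) (hb : 0 ≤ b) (hη : η < 1)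
    (h : ∀ n, |truncation a n - truncation b n| ≤ η) : |a - b| ≤ 2 * η := by
  wlog hab : a ≤ b generalizing a b
  · rw [abs_sub_comm]
    exact this hb ha (fun n => by rw [abs_sub_comm]; exact h n) (le_of_not_ge hab)
  have h0 : ((⌊a⌋₊ : ℕ) : ℝ) ≤ a := Nat.floor_le ha
  have h1 : a < (⌊a⌋₊ : ℕ) + 1 := Nat.lt_floor_add_one a
  have hn := (abs_le.1 (h ⌊a⌋₊)).1
  have hn' := (abs_le.1 (h (⌊a⌋₊ + 1))).1
  unfold truncation at hn hn'
  push_cast at hn'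
  rw [min_eq_right (by linarith), max_eq_right (by linarith)] at hn
  rw [min_eq_right (by linarith), max_eq_left (by linarith)] at hn'
  rw [abs_sub_comm, abs_of_nonneg (by linarith)]
  rcases le_total b (⌊a⌋₊ + 1) with hb1 | hb1
  · rw [min_eq_right (by linarith), max_eq_right (by linarith)] at hn
    linarith
  · rw [min_eq_left (by linarith), max_eq_right zero_le_one] at hn
    have : b - (⌊a⌋₊ + 1) ≤ η := by
      by_contra! hlt
      have : η < max 0 (min 1 (b - (⌊a⌋₊ + 1))) := lt_max_of_lt_right (lt_min hη hlt)
      linarith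
    linarith

/-- The points of the coding metric space: the `k`-th copy of the index `i` at scale `s`, on the
level `n`, is `(((i, s), k), n)`. -/
abbrev GadgetPoint : Type := ((ℕ × ℕ) × ℕ) × ℕ

/-- The weight of two points on the level `n`: it shows the part of `F` above `n`, and
whether both points have scale `n`. -/
noncomputable def levelWeight (F : ℕ × ℕ → ℕ × ℕ → ℝ) (n : ℕ) (x y : (ℕ × ℕ) × ℕ) : ℝ :=
  truncation (F x.1 y.1) n + if x.1.2 = n ∧ y.1.2 = n then 2 else 0

open Classical in
/-- The metric coding `F`: all distances between distinct points lie between `4` and `8`, the value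
`8` marks the steps in the rays `{x} × ℕ`, and distances on the same level are given by
`levelWeight`. -/
noncomputable def gadgetDist (F : ℕ × ℕ → ℕ × ℕ → ℝ) (p q : GadgetPoint) : ℝ :=
  if p = q then 0 else if IsRayStep p q then 8 else
    if p.2 = q.2 then 4 + levelWeight F p.2 p.1 q.1 else 4

section Gadget

variable {F G : ℕ × ℕ → ℕ × ℕ → ℝ}

theorem levelWeight_nonneg (F : ℕ × ℕ → ℕ × ℕ → ℝ) (n : ℕ) (x y : (ℕ × ℕ) × ℕ) :
    0 ≤ levelWeight F n x y := by
  have := truncation_nonneg (F x.1 y.1) n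
  unfold levelWeight
  split_ifs <;> linarith

theorem levelWeight_le (F : ℕ × ℕ → ℕ × ℕ → ℝ) (n : ℕ) (x y : (ℕ × ℕ) × ℕ) :
    levelWeight F n x y ≤ 3 := by
  have := truncation_le_one (F x.1 y.1) n
  unfold levelWeight
  split_ifs <;> linarith

theorem gadgetDist_self (F : ℕ × ℕ → ℕ × ℕ → ℝ) (p : GadgetPoint) : gadgetDist F p p = 0 :=
  if_pos rfl

theorem gadgetDist_of_isRayStep {p q : GadgetPoint} (h : IsRayStep p q) : gadgetDist F p q = 8 := by
  rw [gadgetDist, if_neg h.ne, if_pos h]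

theorem gadgetDist_le_seven {p q : GadgetPoint} (h : ¬ IsRayStep p q) : gadgetDist F p q ≤ 7 := by
  have := levelWeight_le F p.2 p.1 q.1
  rw [gadgetDist, if_neg h]
  split_ifs <;> linarith

theorem gadgetDist_le (p q : GadgetPoint) : gadgetDist F p q ≤ 8 := by
  by_cases h : IsRayStep p q
  · exact (gadgetDist_of_isRayStep h).le
  · exact (gadgetDist_le_seven h).trans (by norm_num)

theorem le_gadgetDist {p q : GadgetPoint} (h : p ≠ q) : 4 ≤ gadgetDist F p q := by
  have := levelWeight_nonneg F p.2 p.1 q.1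
  rw [gadgetDist, if_neg h]
  split_ifs <;> linarith

theorem gadgetDist_level {x y : (ℕ × ℕ) × ℕ} (h : x ≠ y) (n : ℕ) :
    gadgetDist F (x, n) (y, n) = 4 + levelWeight F n x y := by
  rw [gadgetDist, if_neg fun e => h (Prod.mk.inj e).1, if_neg fun e => h e.1, if_pos rfl]

theorem gadgetDist_of_level_ne {p q : GadgetPoint} (hs : ¬ IsRayStep p q) (hl : p.2 ≠ q.2) :
    gadgetDist F p q = 4 := by
  rw [gadgetDist, if_neg fun e => hl (congrArg Prod.snd e), if_neg hs, if_neg hl]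

theorem gadgetDist_comm (hF : ∀ u v, F u v = F v u) (p q : GadgetPoint) :
    gadgetDist F p q = gadgetDist F q p := by
  rcases eq_or_ne p q with rfl | hpq
  · rfl
  by_cases hs : IsRayStep p q
  · rw [gadgetDist_of_isRayStep hs, gadgetDist_of_isRayStep hs.symm]
  by_cases hl : p.2 = q.2
  · obtain ⟨x, n⟩ := p
    obtain ⟨y, m⟩ := q
    obtain rfl : n = m := hl
    have hxy : x ≠ y := fun e => hpq (by rw [e])
    rw [gadgetDist_level hxy, gadgetDist_level hxy.symm, levelWeight, levelWeight, hF]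
    simp only [and_comm]
  · rw [gadgetDist_of_level_ne hs hl, gadgetDist_of_level_ne (fun h => hs h.symm) (Ne.symm hl)]

theorem isMetricOnNat_gadgetDist (hF : ∀ u v, F u v = F v u) (e : ℕ ≃ GadgetPoint) :
    IsMetricOnNat fun i j => gadgetDist F (e i) (e j) := by
  refine ⟨fun i j => ⟨fun h => ?_, ?_⟩, fun i j => gadgetDist_comm hF _ _, fun i j k => ?_⟩
  · by_contra hij
    have := le_gadgetDist (F := F) (e.injective.ne hij)
    linarith
  · rintro rfl
    exact gadgetDist_self F _
  · rcases eq_or_ne i j with rfl | hij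
    · simp [gadgetDist_self]
    rcases eq_or_ne j k with rfl | hjk
    · simp [gadgetDist_self]
    have := le_gadgetDist (F := F) (e.injective.ne hij)
    have := le_gadgetDist (F := F) (e.injective.ne hjk)
    have := gadgetDist_le (F := F) (e i) (e k)
    linarith

theorem HasCorrespondenceFamily.exists_gadget_equiv {ε : ℝ} (hε : 0 ≤ ε)
    (h : HasCorrespondenceFamily ε F G) : ∃ π : GadgetPoint ≃ GadgetPoint,
      ∀ p q, |gadgetDist F p q - gadgetDist G (π p) (π q)| ≤ ε := by
  obtain ⟨φ, hφ, hFG⟩ := h.exists_equiv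
  refine ⟨φ.prodCongr (Equiv.refl ℕ), fun ⟨x, n⟩ ⟨y, m⟩ => ?_⟩
  have hstep : IsRayStep (φ x, n) (φ y, m) ↔ IsRayStep (x, n) (y, m) := by simp [IsRayStep]
  change |gadgetDist F (x, n) (y, m) - gadgetDist G (φ x, n) (φ y, m)| ≤ ε
  by_cases hs : IsRayStep (x, n) (y, m)
  · rw [gadgetDist_of_isRayStep hs, gadgetDist_of_isRayStep (hstep.2 hs)]
    simpa
  rcases eq_or_ne n m with rfl | hl
  · rcases eq_or_ne x y with rfl | hxy
    · simpa [gadgetDist_self]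
    have := (abs_truncation_sub_le (F x.1 y.1) (G (φ x).1 (φ y).1) n).trans (hFG x y)
    rw [gadgetDist_level hxy, gadgetDist_level (φ.injective.ne hxy)]
    simpa only [levelWeight, hφ, add_sub_add_left_eq_sub, add_sub_add_right_eq_sub] using this
  · rw [gadgetDist_of_level_ne hs hl, gadgetDist_of_level_ne (fun h => hs (hstep.1 h)) hl]
    simpa

/-- The coding metric determines the coded structure: an almost isometry preserves the steps
of the rays, hence the rays and the levels, hence the scales and the truncations. -/
theorem hasCorrespondenceFamily_of_gadget_equiv {η : ℝ} (hη : η < 1)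
    (hF0 : ∀ u v, 0 ≤ F u v) (hG0 : ∀ u v, 0 ≤ G u v) (hF : ∀ u, F u u = 0) (hG : ∀ u, G u u = 0)
    (π : GadgetPoint ≃ GadgetPoint)
    (h : ∀ p q, |gadgetDist F p q - gadgetDist G (π p) (π q)| ≤ η) :
    HasCorrespondenceFamily (2 * η) F G := by
  have hη0 : 0 ≤ η := (abs_nonneg _).trans (h ((((0, 0), 0), 0)) ((((0, 0), 0), 0)))
  obtain ⟨φ, hφs, hφ⟩ := exists_map_of_isRayStep_iff π fun p q => by
    have hpq := abs_le.1 (h p q)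
    constructor <;> intro hs <;> by_contra hn
    · rw [gadgetDist_of_isRayStep hs] at hpq
      linarith [gadgetDist_le_seven (F := G) hn]
    · rw [gadgetDist_of_isRayStep hs] at hpq
      linarith [gadgetDist_le_seven (F := F) hn]
  have hφi : ∀ x y, x ≠ y → φ x ≠ φ y := fun x y hxy e => hxy <| by
    have : π (x, 0) = π (y, 0) := by rw [hφ, hφ, e]
    exact (Prod.mk.inj (π.injective this)).1
  have hw : ∀ x y, x ≠ y → ∀ n, |levelWeight F n x y - levelWeight G n (φ x) (φ y)| ≤ η := by
    intro x y hxy n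
    have := h (x, n) (y, n)
    rwa [hφ, hφ, gadgetDist_level hxy, gadgetDist_level (hφi x y hxy), add_sub_add_left_eq_sub]
      at this
  -- the summand `2` of the weights is visible, as the other summands lie in `[0, 1]`
  have hlabel : ∀ x y, x ≠ y → ∀ n, (x.1.2 = n ∧ y.1.2 = n) ↔ ((φ x).1.2 = n ∧ (φ y).1.2 = n) := by
    intro x y hxy n
    have h₁ := abs_le.1 (hw x y hxy n)
    have := truncation_nonneg (F x.1 y.1) n
    have := truncation_le_one (F x.1 y.1) n
    have := truncation_nonneg (G (φ x).1 (φ y).1) n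
    have := truncation_le_one (G (φ x).1 (φ y).1) n
    unfold levelWeight at h₁
    constructor <;> intro hs <;> by_contra hn <;> rw [if_pos hs, if_neg hn] at h₁ <;> linarith
  -- pair `x` with another copy of the same index
  have hscale : ∀ x, (φ x).1.2 = x.1.2 := fun x =>
    ((hlabel x (x.1, x.2 + 1) (fun e => by simpa using congrArg Prod.snd e) x.1.2).1 ⟨rfl, rfl⟩).1
  have hFG : ∀ x y, |F x.1 y.1 - G (φ x).1 (φ y).1| ≤ 2 * η := by
    intro x y
    rcases eq_or_ne x y with rfl | hxy
    · rw [hF, hG]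
      simpa
    · refine abs_sub_le_of_truncation (hF0 _ _) (hG0 _ _) hη fun n => ?_
      have := hw x y hxy n
      simpa only [levelWeight, hscale, add_sub_add_right_eq_sub] using this
  refine ⟨fun s i j => ∃ k l, φ ((i, s), k) = ((j, s), l), fun s => ⟨fun i => ?_, fun j => ?_⟩, ?_⟩
  · exact ⟨(φ ((i, s), 0)).1.1, 0, (φ ((i, s), 0)).2,
      Prod.ext (Prod.ext rfl (hscale _)) rfl⟩
  · obtain ⟨⟨⟨i, s'⟩, k⟩, hx⟩ := hφs ((j, s), 0)
    obtain rfl : s = s' := by simpa [hx] using hscale ((i, s'), k)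
    exact ⟨i, k, 0, hx⟩
  · rintro s t i j i' j' ⟨k, l, h₁⟩ ⟨k', l', h₂⟩
    simpa only [h₁, h₂] using hFG ((i, s), k) ((i', t), k')

end Gadget

/-! ### Both distances on bounded, uniformly discrete codes -/

theorem MetricCode.nonneg (f : MetricCode) (i j : ℕ) : 0 ≤ f.1 i j :=
  dist_nonneg (α := f.Points) (x := i) (y := j)

theorem MetricCode.self_eq_zero (f : MetricCode) (i : ℕ) : f.1 i i = 0 :=
  (f.2.1 i i).2 rfl

/-- All distances between distinct points lie between `4` and `8`. -/
def IsBoundedDiscrete (f : MetricCode) : Prop :=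
  (∀ i j, i ≠ j → 4 ≤ f.1 i j) ∧ ∀ i j, f.1 i j ≤ 8

/-- Some permutation of `ℕ` changes `f` into `g` up to the additive error `ε`. -/
def AlmostIsometric (ε : ℝ) (f g : MetricCode) : Prop :=
  ∃ π : ℕ ≃ ℕ, ∀ i j, |f.1 i j - g.1 (π i) (π j)| ≤ ε

theorem AlmostIsometric.hasCorrespondence {ε : ℝ} {f g : MetricCode}
    (h : AlmostIsometric ε f g) : HasCorrespondence ε f g := by
  obtain ⟨π, hπ⟩ := h
  refine ⟨fun i j => π i = j, ⟨fun i => ⟨_, rfl⟩, fun j => ⟨π.symm j, by simp⟩⟩, ?_⟩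
  rintro i _ i' _ rfl rfl
  exact hπ i i'

/-- A correspondence of distortion below the minimal distance is the graph of a bijection. -/
theorem HasCorrespondence.almostIsometric {c : ℝ} (hc : c < 4) {f g : MetricCode}
    (hf : IsBoundedDiscrete f) (hg : IsBoundedDiscrete g) (h : HasCorrespondence c f g) :
    AlmostIsometric c f g := by
  obtain ⟨R, ⟨hR₁, hR₂⟩, hR⟩ := h
  have hf0 : ∀ i, f.1 i i = 0 := f.self_eq_zero
  have hg0 : ∀ i, g.1 i i = 0 := g.self_eq_zero
  have huniq : ∀ {i j j'}, R i j → R i j' → j = j' := fun {i j j'} h₁ h₂ => by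
    by_contra hne
    have := (abs_le.1 (hR _ _ _ _ h₁ h₂)).1
    rw [hf0] at this
    linarith [hg.1 j j' hne]
  choose φ hφ using hR₁
  have hinj : Function.Injective φ := fun i i' e => by
    by_contra hne
    have := (abs_le.1 (hR _ _ _ _ (hφ i) (hφ i'))).2
    rw [e, hg0] at this
    linarith [hf.1 i i' hne]
  have hsurj : Function.Surjective φ := fun j => by
    obtain ⟨i, hi⟩ := hR₂ j
    exact ⟨i, huniq (hφ i) hi⟩
  exact ⟨Equiv.ofBijective φ ⟨hinj, hsurj⟩, fun i j => hR _ _ _ _ (hφ i) (hφ j)⟩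

theorem BilipEquivalent.mono {K L : ℝ} (hKL : K ≤ L) {M N : Type} [MetricSpace M] [MetricSpace N]
    (h : BilipEquivalent K M N) : BilipEquivalent L M N := by
  obtain ⟨T, h₁, h₂⟩ := h
  exact ⟨T, fun x y => (h₁ x y).trans (by gcongr), fun x y => (h₂ x y).trans (by gcongr)⟩

/-- At distances of at least `4`, an additive error `ε` is at most a factor `1 + ε / 4`. -/
theorem AlmostIsometric.bilipEquivalent {ε : ℝ} {f g : MetricCode}
    (hf : IsBoundedDiscrete f) (hg : IsBoundedDiscrete g) (h : AlmostIsometric ε f g) :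
    BilipEquivalent (1 + ε / 4) f.Space g.Space := by
  obtain ⟨π, hπ⟩ := h
  have hε : 0 ≤ ε := (abs_nonneg _).trans (hπ 0 0)
  have hf0 : ∀ i, f.1 i i = 0 := f.self_eq_zero
  have hg0 : ∀ i, g.1 i i = 0 := g.self_eq_zero
  refine bilipEquivalent_of_denseRange f.denseRange_point
    (b := fun i => g.point (π i)) (g.denseRange_point.comp π.surjective.denseRange
      continuous_of_discreteTopology) (by positivity) (fun i j => ?_) (fun i j => ?_)
  · rw [f.dist_point, g.dist_point]
    rcases eq_or_ne i j with rfl | hij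
    · simp [hf0, hg0]
    · have := (abs_le.1 (hπ i j)).1
      nlinarith [hf.1 i j hij]
  · rw [f.dist_point, g.dist_point]
    rcases eq_or_ne i j with rfl | hij
    · simp [hf0, hg0]
    · have := (abs_le.1 (hπ i j)).2
      nlinarith [hg.1 _ _ (π.injective.ne hij)]

/-- A uniformly discrete space is its own completion. -/
theorem IsBoundedDiscrete.bijective_point {f : MetricCode} (hf : IsBoundedDiscrete f) :
    Function.Bijective f.point := by
  refine ⟨fun i j h => ?_, fun x => ?_⟩
  · rw [← f.2.1, ← f.dist_point, h, dist_self]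
  · obtain ⟨i, hi⟩ := f.denseRange_point.exists_dist_lt x (ε := 1) one_pos
    refine ⟨i, (eq_of_forall_dist_le fun ε hε => ?_).symm⟩
    obtain ⟨j, hj⟩ := f.denseRange_point.exists_dist_lt x (lt_min hε one_pos)
    -- `j` and `i` are at distance less than `2`
    obtain rfl : i = j := by
      by_contra hne
      have h₁ := hf.1 i j hne
      rw [← f.dist_point] at h₁
      have := dist_triangle_left (f.point i) (f.point j) x
      have := hj.trans_le (min_le_right _ _)
      linarith
    exact (hj.trans_le (min_le_left _ _)).le

/-- At distances of at most `8`, a factor `K` is at most an additive error `8 * (K - 1)`. -/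
theorem BilipEquivalent.almostIsometric {K : ℝ} (hK : 1 ≤ K) {f g : MetricCode}
    (hf : IsBoundedDiscrete f) (hg : IsBoundedDiscrete g)
    (h : BilipEquivalent K f.Space g.Space) : AlmostIsometric (8 * (K - 1)) f g := by
  obtain ⟨T, h₁, h₂⟩ := h
  let ef := Equiv.ofBijective f.point hf.bijective_point
  let eg := Equiv.ofBijective g.point hg.bijective_point
  refine ⟨(ef.trans T).trans eg.symm, fun i j => ?_⟩
  have hT : ∀ i, g.point (((ef.trans T).trans eg.symm) i) = T (f.point i) := fun i =>
    eg.apply_symm_apply _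
  have h₁' := h₁ (f.point i) (f.point j)
  have h₂' := h₂ (f.point i) (f.point j)
  rw [← hT, ← hT, f.dist_point, g.dist_point] at h₁' h₂'
  have := hf.2 i j
  have := hg.2 (((ef.trans T).trans eg.symm) i) (((ef.trans T).trans eg.symm) j)
  rw [abs_le]
  constructor <;> nlinarith

/-! ### The coding map -/

/-- An enumeration of the points of the coding space. -/
def gadgetEnum : ℕ ≃ GadgetPoint := (Denumerable.eqv GadgetPoint).symm

/-- The code of the metric `gadgetDist F`, for an enumeration of its points. -/
noncomputable def gadgetCode (F : ℕ × ℕ → ℕ × ℕ → ℝ) (hF : ∀ u v, F u v = F v u) : MetricCode :=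
  ⟨fun i j => gadgetDist F (gadgetEnum i) (gadgetEnum j), isMetricOnNat_gadgetDist hF _⟩

theorem isBoundedDiscrete_gadgetCode (F : ℕ × ℕ → ℕ × ℕ → ℝ) (hF : ∀ u v, F u v = F v u) :
    IsBoundedDiscrete (gadgetCode F hF) := by
  refine ⟨fun i j h => ?_, fun i j => ?_⟩
  · exact le_gadgetDist (F := F) (gadgetEnum.injective.ne h)
  · exact gadgetDist_le (F := F) (gadgetEnum i) (gadgetEnum j)

theorem measurable_gadgetCode {F : MetricCode → ℕ × ℕ → ℕ × ℕ → ℝ}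
    (hF : ∀ f u v, F f u v = F f v u) (hFm : ∀ u v, Measurable fun f => F f u v) :
    Measurable fun f => gadgetCode (F f) (hF f) := by
  refine Measurable.subtype_mk (measurable_pi_iff.2 fun i => measurable_pi_iff.2 fun j => ?_)
  generalize gadgetEnum i = p
  generalize gadgetEnum j = q
  unfold gadgetDist levelWeight truncation
  split_ifs
  · exact measurable_const
  · exact measurable_const
  · exact measurable_const.add ((measurable_const.max (measurable_const.min
      ((hFm _ _).sub measurable_const))).add measurable_const)
  · exact measurable_const.add ((measurable_const.max (measurable_const.min
      ((hFm _ _).sub measurable_const))).add measurable_const)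
  · exact measurable_const

section

variable {F G : ℕ × ℕ → ℕ × ℕ → ℝ} {hF : ∀ u v, F u v = F v u} {hG : ∀ u v, G u v = G v u}

theorem HasCorrespondenceFamily.almostIsometric {ε : ℝ} (hε : 0 ≤ ε)
    (h : HasCorrespondenceFamily ε F G) :
    AlmostIsometric ε (gadgetCode F hF) (gadgetCode G hG) := by
  obtain ⟨π, hπ⟩ := h.exists_gadget_equiv hε
  refine ⟨(gadgetEnum.trans π).trans gadgetEnum.symm,
    fun i j => ?_⟩
  simpa [gadgetCode] using hπ (gadgetEnum i)
    (gadgetEnum j)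

theorem AlmostIsometric.hasCorrespondenceFamily {η : ℝ} (hη : η < 1)
    (hF0 : ∀ u v, 0 ≤ F u v) (hG0 : ∀ u v, 0 ≤ G u v) (hFd : ∀ u, F u u = 0) (hGd : ∀ u, G u u = 0)
    (h : AlmostIsometric η (gadgetCode F hF) (gadgetCode G hG)) :
    HasCorrespondenceFamily (2 * η) F G := by
  obtain ⟨π, hπ⟩ := h
  refine hasCorrespondenceFamily_of_gadget_equiv hη hF0 hG0 hFd hGd
    ((gadgetEnum.symm.trans π).trans gadgetEnum)
    fun p q => ?_
  simpa [gadgetCode] using hπ (gadgetEnum.symm p) (gadgetEnum.symm q)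

end

/-! ### Reduction of the Gromov–Hausdorff distance to the Lipschitz distance -/

/-- The distances of `f` as weights that ignore the scales. -/
def distWeight (f : MetricCode) (u v : ℕ × ℕ) : ℝ := f.1 u.1 v.1

theorem distWeight_comm (f : MetricCode) (u v : ℕ × ℕ) : distWeight f u v = distWeight f v u :=
  f.2.2.1 _ _

theorem distWeight_nonneg (f : MetricCode) (u v : ℕ × ℕ) : 0 ≤ distWeight f u v :=
  f.nonneg _ _

theorem distWeight_self (f : MetricCode) (u : ℕ × ℕ) : distWeight f u u = 0 :=
  f.self_eq_zero _

theorem HasCorrespondence.family {c : ℝ} {f g : MetricCode} (h : HasCorrespondence c f g) :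
    HasCorrespondenceFamily c (distWeight f) (distWeight g) := by
  obtain ⟨R, hR, h⟩ := h
  exact ⟨fun _ => R, fun _ => hR, fun _ _ i j i' j' h₁ h₂ => h i j i' j' h₁ h₂⟩

theorem HasCorrespondenceFamily.hasCorrespondence {c : ℝ} {f g : MetricCode}
    (h : HasCorrespondenceFamily c (distWeight f) (distWeight g)) : HasCorrespondence c f g := by
  obtain ⟨R, hR, h⟩ := h
  exact ⟨R 0, hR 0, fun i j i' j' h₁ h₂ => h 0 0 i j i' j' h₁ h₂⟩

theorem borelUnifReducible_rhoGH_rhoL : BorelUnifReducible rhoGH rhoL := by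
  refine ⟨fun f => gadgetCode (distWeight f) (distWeight_comm f),
    measurable_gadgetCode _ fun u v => MetricCode.measurable_apply _ _, fun ε hε => ?_⟩
  -- `8 * (exp δ - 1)` is the additive error of an `exp δ`-Lipschitz map at distances up to `8`
  obtain ⟨δ, hδ, hδε⟩ : ∃ δ : ℝ, 0 < δ ∧ 8 * (Real.exp δ - 1) < min (1 / 2) ε := by
    have hlim : Filter.Tendsto (fun δ : ℝ => 8 * (Real.exp δ - 1)) (nhdsWithin 0 (Ioi 0))
        (nhds 0) := by
      have : Continuous fun δ : ℝ => 8 * (Real.exp δ - 1) := by fun_prop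
      simpa using (this.tendsto 0).mono_left nhdsWithin_le_nhds
    obtain ⟨δ, h₁, h₂⟩ := ((hlim.eventually_lt_const (show (0 : ℝ) < min (1 / 2) ε by
      positivity)).and self_mem_nhdsWithin).exists
    exact ⟨δ, h₂, h₁⟩
  refine ⟨ε, δ, hε, hδ, fun f g h => ?_, fun f g h => ?_⟩
  · obtain ⟨t, ht, htε, hfg⟩ := exists_hasCorrespondence_of_rhoGH_lt h
    have := (hfg.family.almostIsometric (hF := distWeight_comm f) (hG := distWeight_comm g)
      (by positivity)).bilipEquivalent
      (isBoundedDiscrete_gadgetCode _ _) (isBoundedDiscrete_gadgetCode _ _)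
    refine (lipschitzEDist_le ht (this.mono ?_)).trans_lt
      ((ENNReal.ofReal_lt_ofReal_iff hε).2 htε)
    linarith [Real.add_one_le_exp t]
  · obtain ⟨t, ht, htδ, hfg⟩ := exists_bilipEquivalent_of_lipschitzEDist_lt h
    have hη : 8 * (Real.exp t - 1) < min (1 / 2) ε := lt_of_le_of_lt (by gcongr) hδε
    have := (hfg.almostIsometric (Real.one_le_exp ht) (isBoundedDiscrete_gadgetCode _ _)
      (isBoundedDiscrete_gadgetCode _ _)).hasCorrespondenceFamily
      (hη.trans_le ((min_le_left _ _).trans (by norm_num)))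
      (distWeight_nonneg f) (distWeight_nonneg g) (distWeight_self f) (distWeight_self g)
    exact rhoGH_lt (by linarith [Real.one_le_exp ht]) (hη.trans_le (min_le_right _ _))
      this.hasCorrespondence

/-! ### Reduction of the Lipschitz distance to the Gromov–Hausdorff distance -/

/-- The radius `2⁻ˢ + 2⁻ᵗ` at which the scales `s` and `t` look at a distance. -/
noncomputable def scaleSum (s t : ℕ) : ℝ := (1 / 2) ^ s + (1 / 2) ^ t

theorem scaleSum_pos (s t : ℕ) : 0 < scaleSum s t := by
  unfold scaleSum
  positivity

/-- The weights of `f` for the reduction of the Lipschitz distance: an additive error in these is a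
multiplicative error in the distances, blurred at the radius `2⁻ˢ + 2⁻ᵗ`. -/
noncomputable def logWeight (f : MetricCode) (u v : ℕ × ℕ) : ℝ :=
  Real.log (1 + f.1 u.1 v.1 / scaleSum u.2 v.2)

theorem logWeight_comm (f : MetricCode) (u v : ℕ × ℕ) : logWeight f u v = logWeight f v u := by
  rw [logWeight, logWeight, scaleSum, scaleSum, f.2.2.1, add_comm ((1 / 2 : ℝ) ^ u.2)]

theorem one_le_logWeight_arg (f : MetricCode) (i j s t : ℕ) : 1 ≤ 1 + f.1 i j / scaleSum s t :=
  le_add_of_nonneg_right (div_nonneg (f.nonneg i j) (scaleSum_pos s t).le)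

theorem logWeight_nonneg (f : MetricCode) (u v : ℕ × ℕ) : 0 ≤ logWeight f u v :=
  Real.log_nonneg (one_le_logWeight_arg f _ _ _ _)

theorem logWeight_self (f : MetricCode) (u : ℕ × ℕ) : logWeight f u u = 0 := by
  simp [logWeight, f.self_eq_zero]

theorem measurable_logWeight (u v : ℕ × ℕ) : Measurable fun f => logWeight f u v :=
  Real.measurable_log.comp
    (measurable_const.add ((MetricCode.measurable_apply _ _).div_const _))

/-- A weight inequality is an inequality between blurred distances. -/
theorem logWeight_le_add_iff (f g : MetricCode) (i i' j j' s t : ℕ) (c : ℝ) :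
    logWeight g (j, s) (j', t) ≤ c + logWeight f (i, s) (i', t) ↔
      scaleSum s t + g.1 j j' ≤ Real.exp c * (scaleSum s t + f.1 i i') := by
  have hs := scaleSum_pos s t
  have hf := one_le_logWeight_arg f i i' s t
  have hg := one_le_logWeight_arg g j j' s t
  have e : ∀ a : ℝ, scaleSum s t + a = scaleSum s t * (1 + a / scaleSum s t) := fun a => by
    field_simp
  unfold logWeight
  rw [Real.log_le_iff_le_exp (by linarith), Real.exp_add, Real.exp_log (by linarith), e, e,
    mul_left_comm, mul_le_mul_iff_right₀ hs]

/-- Nearby points of the completions, at a distance proportional to the scale, are related. -/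
theorem BilipEquivalent.family {t u : ℝ} (htu : t < u) (ht : 0 ≤ t) {f g : MetricCode}
    (h : BilipEquivalent (Real.exp t) f.Space g.Space) :
    HasCorrespondenceFamily u (logWeight f) (logWeight g) := by
  obtain ⟨T, h₁, h₂⟩ := h
  -- the blur `δ` fits between the factors `exp t` and `exp u`
  obtain ⟨δ, hδ, hexp⟩ : ∃ δ : ℝ, 0 < δ ∧ Real.exp t * (1 + δ) = Real.exp u := by
    refine ⟨Real.exp (u - t) - 1, by linarith [Real.add_one_le_exp (u - t)], ?_⟩
    rw [add_sub_cancel, ← Real.exp_add, add_sub_cancel]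
  have hK : 1 ≤ Real.exp t := Real.one_le_exp ht
  refine ⟨fun s i j => dist (T (f.point i)) (g.point j) < δ * (1 / 2) ^ s,
    fun s => ⟨fun i => ?_, fun j => ?_⟩, fun s r i j i' j' hi hi' => ?_⟩
  · exact g.denseRange_point.exists_dist_lt _ (by positivity)
  · obtain ⟨i, hi⟩ := f.denseRange_point.exists_dist_lt (T.symm (g.point j))
      (show 0 < δ * (1 / 2) ^ s / Real.exp t by positivity)
    refine ⟨i, ?_⟩
    have := h₁ (f.point i) (T.symm (g.point j))
    rw [T.apply_symm_apply, dist_comm (f.point i)] at this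
    refine this.trans_lt ?_
    rwa [lt_div_iff₀' (Real.exp_pos t)] at hi
  · replace hi : dist (T (f.point i)) (g.point j) < δ * (1 / 2) ^ s := hi
    replace hi' : dist (T (f.point i')) (g.point j') < δ * (1 / 2) ^ r := hi'
    have hs := scaleSum_pos s r
    have hsum : δ * (1 / 2) ^ s + δ * (1 / 2) ^ r = δ * scaleSum s r := by
      rw [scaleSum, mul_add]
    have h₁' := h₁ (f.point i) (f.point i')
    have h₂' := h₂ (f.point i) (f.point i')
    rw [f.dist_point] at h₁' h₂'
    have h₃ : g.1 j j' ≤ dist (T (f.point i)) (T (f.point i')) + δ * scaleSum s r := by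
      rw [← g.dist_point]
      have := dist_triangle4 (g.point j) (T (f.point i)) (T (f.point i')) (g.point j')
      rw [dist_comm (g.point j) (T (f.point i))] at this
      linarith
    have h₄ : dist (T (f.point i)) (T (f.point i')) ≤ g.1 j j' + δ * scaleSum s r := by
      rw [← g.dist_point]
      have := dist_triangle4 (T (f.point i)) (g.point j) (g.point j') (T (f.point i'))
      rw [dist_comm (g.point j') (T (f.point i'))] at this
      linarith
    have hf := f.nonneg i i'
    have hg := g.nonneg j j'
    have e₁ := (logWeight_le_add_iff f g i i' j j' s r u).2 (by
      rw [← hexp]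
      nlinarith [mul_nonneg hδ.le hs.le, mul_nonneg hδ.le hf, mul_nonneg (mul_nonneg hδ.le hs.le)
        (sub_nonneg.2 hK), mul_nonneg (mul_nonneg hδ.le hf) (Real.exp_pos t).le,
        mul_nonneg hs.le (sub_nonneg.2 hK)])
    have e₂ := (logWeight_le_add_iff g f j j' i i' s r u).2 (by
      rw [← hexp]
      have := mul_le_mul_of_nonneg_left h₄ (Real.exp_pos t).le
      nlinarith [mul_nonneg (mul_nonneg hδ.le hg) (Real.exp_pos t).le,
        mul_nonneg hs.le (sub_nonneg.2 hK)])
    rw [abs_le]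
    constructor <;> linarith

/-- The related indices of `i` on finer and finer scales converge in the completion, and the limits
define a bi-Lipschitz bijection. -/
theorem HasCorrespondenceFamily.bilipEquivalent {c : ℝ} {f g : MetricCode}
    (h : HasCorrespondenceFamily c (logWeight f) (logWeight g)) :
    BilipEquivalent (Real.exp c) f.Space g.Space := by
  obtain ⟨R, hR, h⟩ := h
  have hfg : ∀ {s t i j i' j'}, R s i j → R t i' j' →
      scaleSum s t + g.1 j j' ≤ Real.exp c * (scaleSum s t + f.1 i i') := fun h₁ h₂ =>
    (logWeight_le_add_iff f g _ _ _ _ _ _ c).1 (by linarith [(abs_le.1 (h _ _ _ _ _ _ h₁ h₂)).1])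
  have hgf : ∀ {s t i j i' j'}, R s i j → R t i' j' →
      scaleSum s t + f.1 i i' ≤ Real.exp c * (scaleSum s t + g.1 j j') := fun h₁ h₂ =>
    (logWeight_le_add_iff g f _ _ _ _ _ _ c).1 (by linarith [(abs_le.1 (h _ _ _ _ _ _ h₁ h₂)).2])
  have hself : ∀ {s t i j j'}, R s i j → R t i j' →
      dist (g.point j) (g.point j') ≤ Real.exp c * scaleSum s t := fun h₁ h₂ => by
    have := hfg h₁ h₂
    rw [f.self_eq_zero, add_zero] at this
    rw [g.dist_point]
    exact (le_add_of_nonneg_left (scaleSum_pos _ _).le).trans this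
  choose J hJ using fun i s => (hR s).1 i
  have hpow : Filter.Tendsto (fun s : ℕ => (1 / 2 : ℝ) ^ s) Filter.atTop (nhds 0) :=
    tendsto_pow_atTop_nhds_zero_of_lt_one (by norm_num) (by norm_num)
  have hscale : Filter.Tendsto (fun s : ℕ => scaleSum s s) Filter.atTop (nhds 0) := by
    simpa [scaleSum] using hpow.add hpow
  have hlim : ∀ i, ∃ y, Filter.Tendsto (fun s => g.point (J i s)) Filter.atTop (nhds y) := by
    intro i
    refine cauchySeq_tendsto_of_complete (cauchySeq_of_le_tendsto_0
      (fun N => Real.exp c * scaleSum N N) (fun m n N hm hn =>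
        (hself (hJ i m) (hJ i n)).trans ?_) ?_)
    · unfold scaleSum
      gcongr ?_ * (?_ + ?_)
      · exact pow_le_pow_of_le_one (by norm_num) (by norm_num) hm
      · exact pow_le_pow_of_le_one (by norm_num) (by norm_num) hn
    · simpa using hscale.const_mul (Real.exp c)
  choose y hy using hlim
  have hdist : ∀ i j, Filter.Tendsto (fun s => scaleSum s s + g.1 (J i s) (J j s)) Filter.atTop
      (nhds (dist (y i) (y j))) := fun i j => by
    simpa [g.dist_point] using hscale.add ((hy i).dist (hy j))
  have hsf : ∀ i j, Filter.Tendsto (fun s => scaleSum s s + f.1 i j) Filter.atTop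
      (nhds (f.1 i j)) := fun i j => by
    simpa using hscale.add_const (f.1 i j)
  refine bilipEquivalent_of_denseRange f.denseRange_point (b := y) ?_ (Real.exp_pos c).le
    (fun i j => ?_) (fun i j => ?_)
  · refine Metric.denseRange_iff.2 fun z r hr => ?_
    obtain ⟨j, hj⟩ := g.denseRange_point.exists_dist_lt z (half_pos hr)
    have hsmall : Filter.Tendsto (fun s : ℕ => Real.exp c * (1 / 2) ^ s) Filter.atTop (nhds 0) := by
      simpa using hpow.const_mul (Real.exp c)
    obtain ⟨s, hs⟩ := (hsmall.eventually_lt_const (half_pos hr)).exists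
    obtain ⟨i, hi⟩ := (hR s).2 j
    have hle : dist (g.point j) (y i) ≤ Real.exp c * (1 / 2) ^ s := by
      refine le_of_tendsto_of_tendsto' (tendsto_const_nhds.dist (hy i)) (b := Filter.atTop) ?_
        fun t => hself hi (hJ i t)
      simpa [scaleSum] using (hpow.const_add ((1 / 2 : ℝ) ^ s)).const_mul (Real.exp c)
    exact ⟨i, by linarith [dist_triangle z (g.point j) (y i)]⟩
  · rw [f.dist_point]
    exact le_of_tendsto_of_tendsto' (hdist i j) ((hsf i j).const_mul _)
      fun s => hfg (hJ i s) (hJ j s)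
  · rw [f.dist_point]
    exact le_of_tendsto_of_tendsto' (hsf i j) ((hdist i j).const_mul _)
      fun s => hgf (hJ i s) (hJ j s)

theorem borelUnifReducible_rhoL_rhoGH : BorelUnifReducible rhoL rhoGH := by
  refine ⟨fun f => gadgetCode (logWeight f) (logWeight_comm f),
    measurable_gadgetCode _ measurable_logWeight, fun ε hε => ?_⟩
  have hm : 0 < min (1 / 4) (ε / 4) := by positivity
  refine ⟨ε, min (1 / 4) (ε / 4), hε, hm, fun f g h => ?_, fun f g h => ?_⟩
  · obtain ⟨t, ht, htε, hfg⟩ := exists_bilipEquivalent_of_lipschitzEDist_lt h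
    obtain ⟨u, htu, huε⟩ := exists_between htε
    have := ((hfg.family htu ht).almostIsometric (hF := logWeight_comm f) (hG := logWeight_comm g)
      (by linarith)).hasCorrespondence
    exact rhoGH_lt (t := u / 2) (by linarith) (by linarith) (by rwa [mul_div_cancel₀ _ two_ne_zero])
  · obtain ⟨t, ht, htδ, hfg⟩ := exists_hasCorrespondence_of_rhoGH_lt h
    have h₁ := htδ.trans_le (min_le_left _ _)
    have h₂ := htδ.trans_le (min_le_right _ _)
    have := ((hfg.almostIsometric (by linarith) (isBoundedDiscrete_gadgetCode _ _)
      (isBoundedDiscrete_gadgetCode _ _)).hasCorrespondenceFamily (by linarith)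
      (logWeight_nonneg f) (logWeight_nonneg g) (logWeight_self f)
      (logWeight_self g)).bilipEquivalent
    exact (lipschitzEDist_le (by positivity) this).trans_lt
      ((ENNReal.ofReal_lt_ofReal_iff hε).2 (by linarith))

theorem mainTheorem6 :
    IsAnalyticPseudometric rhoGH ∧ IsAnalyticPseudometric rhoL ∧
      BorelUnifBireducible rhoGH rhoL :=
  ⟨isAnalyticPseudometric_rhoGH, isAnalyticPseudometric_rhoL,
    borelUnifReducible_rhoGH_rhoL, borelUnifReducible_rhoL_rhoGH⟩
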